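/- Let $F$ be a field of characteristic not $2$ and let $A$ be a commutative, not necessarily associative, unital or finite-dimensional, $F$-algebra. For $e\in A$ let $\mathrm{ad}_e(x)=ex$ and, for $\mu\in F$, $A_\mu(e)=\{x\in A: ex=\mu x\}$. A nonzero idempotent $e\in A$ is called semisimple if $\mathrm{ad}_e$ is diagonalizable, i.e. $A=\sum_{\mu\in F} A_\mu(e)$, and primitive if $A_1(e)=Fe$. A (primitive) axis of $A$ is a primitive semisimple idempotent $e$ such that the eigenvalues of $\mathrm{ad}_e$ lie in $\{0,1/2,1\}$ and $$A_0(e)^2\subseteq A_0(e),\quad A_{1/2}(e)^2\subseteq A_0(e)+A_1(e),\quad (A_0(e)+A_1(e))A_{1/2}(e)\subseteq A_{1/2}(e),\quad A_0(e)A_1(e)=(0).$$ Suppose that $A$ is an axial algebra of Jordan type $1/2$, i.e. that $A$ is generated as an algebra by axes. Then $A$ carries a unique Frobenius form, i.e. a unique symmetric bilinear form $(\cdot,\cdot)\colon A\times A\to F$ with $(xy,z)=(x,yz)$ for all $x,y,z\in A$ and $(e,e)=1$ for every axis $e\in A$. With respect to this form, if $a,b\in A$ are distinct axes with $(a,b)\neq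 1$, then $$x_a(b)=\frac{2ab-(a,b)a-b}{(a,b)-1}$$ is a primitive semisimple idempotent of $A$ (in particular it is nonzero), and all eigenvalues of $\mathrm{ad}_{x_a(b)}$ lie in $\{0,1/2,1\}$. -/

import Mathlib

/-!  Primitive axial algebras of Jordan type.  Here `A` is a commutative, not necessarily associative
or unital, algebra over a field `F`. -/

namespace AxialAlgebra

section Defs

variable (F : Type*) {A : Type*} [Field F] [NonUnitalNonAssocCommRing A] [Module F A]
  [SMulCommClass F A A] [IsScalarTower F A A]

/-- The adjoint operator `ad_a : x ↦ a * x`. -/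
def ad (a : A) : Module.End F A := LinearMap.mulLeft F a

/-- The subspace `A_μ(a) = {x | a * x = μ • x}`. -/
def eig (a : A) (μ : F) : Submodule F A := Module.End.eigenspace (ad F a) μ

/-- A nonzero idempotent `e` whose adjoint operator is semisimple (diagonalizable: `A` is the sum of
the eigenspaces of `ad_e`) and which is primitive (`A_1(e) = F e`). -/
structure IsPrimitiveSemisimpleIdempotent (e : A) : Prop where
  ne_zero : e ≠ 0
  idem : e * e = e
  semisimple : ⨆ μ : F, eig F e μ = ⊤
  primitive : eig F e 1 = Submodule.span F {e}

/-- The eigenvalues of `ad_e` lie in `{0, η, 1}`. -/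
def EigenvaluesIn (η : F) (e : A) : Prop :=
  ∀ μ : F, (ad F e).HasEigenvalue μ → μ = 0 ∨ μ = η ∨ μ = 1

/-- A (primitive) axis of Jordan type `η`: a primitive semisimple idempotent with eigenvalues in
`{0, η, 1}` satisfying the fusion rules of Jordan type `η`. -/
structure IsAxis (η : F) (e : A) : Prop extends IsPrimitiveSemisimpleIdempotent F e where
  eigenvalues : EigenvaluesIn F η e
  fusion_zero_zero : ∀ x ∈ eig F e 0, ∀ y ∈ eig F e 0, x * y ∈ eig F e 0
  fusion_eta_eta : ∀ x ∈ eig F e η, ∀ y ∈ eig F e η, x * y ∈ eig F e 0 ⊔ eig F e 1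
  fusion_even_eta : ∀ x ∈ eig F e 0 ⊔ eig F e 1, ∀ y ∈ eig F e η, x * y ∈ eig F e η
  fusion_zero_one : ∀ x ∈ eig F e 0, ∀ y ∈ eig F e 1, x * y = 0

variable (A) in
/-- `A` is a (primitive) axial algebra of Jordan type `η`: it is generated by axes. -/
def IsJordanType (η : F) : Prop :=
  ∃ X : Set A, (∀ e ∈ X, IsAxis F η e) ∧ NonUnitalAlgebra.adjoin F X = ⊤

variable {F}

/-- A Frobenius form on an axial algebra of Jordan type `η`: a symmetric invariant bilinear form
with `(e, e) = 1` for every axis `e` (hence nonzero as soon as `A ≠ 0`). -/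
structure IsFrobeniusForm (η : F) (f : LinearMap.BilinForm F A) : Prop where
  symm : ∀ x y, f x y = f y x
  invariant : ∀ x y z, f (x * y) z = f x (y * z)
  normalized : ∀ e, IsAxis F η e → f e e = 1

/-- `x_a(b) = (2ab - (a,b)a - b) / ((a,b) - 1)`, meaningful when `(a,b) ≠ 1`. -/
def xElem (f : LinearMap.BilinForm F A) (a b : A) : A :=
  (f a b - 1)⁻¹ • ((2 : F) • (a * b) - f a b • a - b)

end Defs

end AxialAlgebra

set_option linter.unusedSectionVars false

namespace AxialAlgebra

section

variable {F A : Type*} [Field F] [NonUnitalNonAssocCommRing A] [Module F A]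
  [SMulCommClass F A A] [IsScalarTower F A A]

/-! Everything reduces to the identity `2a(ax) = ax + l(x)a` of `IsCoord`. The polynomial `2t² - t`
vanishes at `0` and `1/2` and equals `1` at `1`, so for a nonzero idempotent `a` the identity, for
some linear form `l`, says exactly that `a` is primitive and semisimple with spectrum in `{0, 1/2,
1}`. The fusion rules are not needed for this.

The form should satisfy `(a, ·) = l` at each axis `a`. Miyamoto involutions are automorphisms, so
axes span `A`. The coordinates are symmetric (`IsAxis.coord_symm`) because multiplication by `s = a
+ b - 2ab` commutes with multiplication by `a` and by `b`. Hence the form exists and is unique, and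
its invariance follows from its invariance under Miyamoto involutions.

With `φ = (a, b)`, the element `x_a(b)` is `x / (1 - φ)`, where `x = s - (1 - φ)a` is the
`A_0(a)`-component of `b`. The relation `s² = (1 - φ)s` gives idempotence. The main work is
`IsFrobeniusForm.zeroPart_mul_zeroPart_mul`, which after rescaling is the `IsCoord` identity for
`x_a(b)`. -/

lemma mem_eig {a x : A} {μ : F} : x ∈ eig F a μ ↔ a * x = μ • x := by
  simp [eig, ad]

/-! ### Peirce decomposition encoded by one quadratic identity -/

/-- A linear endomorphism with values in the line spanned by `a` is given by a linear form. -/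
lemma exists_dual_of_forall_mem_span {a : A} (ha : a ≠ 0) (T : A →ₗ[F] A)
    (hT : ∀ x, T x ∈ Submodule.span F {a}) : ∃ l : Module.Dual F A, ∀ x, T x = l x • a := by
  refine ⟨(LinearEquiv.toSpanNonzeroSingleton F A a ha).symm.toLinearMap ∘ₗ
    T.codRestrict _ hT, fun x => ?_⟩
  have h := congrArg Subtype.val
    ((LinearEquiv.toSpanNonzeroSingleton F A a ha).apply_symm_apply (T.codRestrict _ hT x))
  rw [LinearEquiv.toSpanNonzeroSingleton_apply] at h
  exact h.symm

/-- The linear form `l` computes the coefficient of `a` in the `A_1(a)`-component. -/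
def IsCoord (a : A) (l : Module.Dual F A) : Prop :=
  ∀ x, (2 : F) • (a * (a * x)) = a * x + l x • a

lemma IsAxis.exists_isCoord (hF : (2 : F) ≠ 0) {a : A} (ha : IsAxis F (1 / 2) a) :
    ∃ l : Module.Dual F A, IsCoord a l := by
  obtain ⟨l, hl⟩ := exists_dual_of_forall_mem_span ha.ne_zero
    ((2 : F) • (ad F a * ad F a) - ad F a) (fun x => by
      have hx : x ∈ ⨆ μ : F, eig F a μ := by rw [ha.semisimple]; trivial
      induction hx using Submodule.iSup_induction' with
      | mem μ x hx =>
        by_cases h0 : x = 0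
        · simp [h0]
        have hμ := ha.eigenvalues μ (Module.End.hasEigenvalue_of_hasEigenvector ⟨hx, h0⟩)
        have hx' := mem_eig.1 hx
        have e : ((2 : F) • (ad F a * ad F a) - ad F a) x = (2 * μ * μ - μ) • x := by
          simp only [ad, LinearMap.sub_apply, LinearMap.smul_apply, Module.End.mul_apply,
            LinearMap.mulLeft_apply, hx', mul_smul_comm]
          module
        rw [e]
        rcases hμ with rfl | rfl | rfl
        · simp
        · have : (2 * (1 / 2) * (1 / 2) - 1 / 2 : F) = 0 := by field_simp; ring
          rw [this, zero_smul]; exact zero_mem _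
        · rw [← ha.primitive]
          exact Submodule.smul_mem _ _ hx
      | zero => simp
      | add x y _ _ hx hy => rw [map_add]; exact Submodule.add_mem _ hx hy)
  refine ⟨l, fun x => ?_⟩
  rw [← hl x]
  simp [ad]

/-- The projection of `x` to `A_{1/2}(a)`. -/
def halfPart (a : A) (l : Module.Dual F A) : A →ₗ[F] A :=
  (2 : F) • ad F a - (2 : F) • l.smulRight a

lemma halfPart_apply (a : A) (l : Module.Dual F A) (x : A) :
    halfPart a l x = (2 : F) • (a * x) - (2 * l x) • a := by
  simp [halfPart, ad, mul_smul]

namespace IsCoord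

variable {a : A} {l : Module.Dual F A}

lemma self (h0 : a ≠ 0) (hi : a * a = a) (h : IsCoord a l) : l a = 1 := by
  have := h a
  rw [hi, hi] at this
  have h2 : (l a - 1) • a = 0 := by linear_combination (norm := module) -this
  exact sub_eq_zero.1 ((smul_eq_zero.1 h2).resolve_right h0)

lemma unique (h0 : a ≠ 0) {l' : Module.Dual F A} (h : IsCoord a l) (h' : IsCoord a l') :
    l = l' := by
  ext x
  have h3 : (l x - l' x) • a = 0 := by linear_combination (norm := module) h' x - h x
  exact sub_eq_zero.1 ((smul_eq_zero.1 h3).resolve_right h0)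

lemma halfPart_mem (hF : (2 : F) ≠ 0) (hi : a * a = a) (h : IsCoord a l) (x : A) :
    halfPart a l x ∈ eig F a (1 / 2) := by
  rw [mem_eig, halfPart_apply, mul_sub, mul_smul_comm, mul_smul_comm, hi]
  have e : (1 / 2 : F) • ((2 : F) • (a * x) - (2 * l x) • a) = a * x - l x • a := by
    match_scalars <;> field_simp
  rw [e]
  linear_combination (norm := module) h x

lemma zeroPart_mem (hi : a * a = a) (h : IsCoord a l) (x : A) :
    x - (2 : F) • (a * x) + l x • a ∈ eig F a 0 := by
  rw [mem_eig, mul_add, mul_sub, mul_smul_comm, mul_smul_comm, hi]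
  linear_combination (norm := module) -h x

lemma coord_of_mem_half (hF : (2 : F) ≠ 0) (h0 : a ≠ 0) (h : IsCoord a l) {x : A}
    (hx : x ∈ eig F a (1 / 2)) : l x = 0 := by
  have h1 := h x
  rw [mem_eig] at hx
  rw [hx, mul_smul_comm, hx] at h1
  have e : (2 : F) • (1 / 2 : F) • (1 / 2 : F) • x = (1 / 2 : F) • x := by
    match_scalars; field_simp
  rw [e] at h1
  exact (smul_eq_zero.1 (add_eq_left.1 h1.symm)).resolve_right h0

lemma coord_of_mem_zero (h0 : a ≠ 0) (h : IsCoord a l) {x : A}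
    (hx : x ∈ eig F a 0) : l x = 0 := by
  have h1 := h x
  rw [mem_eig, zero_smul] at hx
  rw [hx, mul_zero, smul_zero, zero_add] at h1
  exact (smul_eq_zero.1 h1.symm).resolve_right h0

/-- Converse to `IsAxis.exists_isCoord`: the identity alone makes the three Peirce projections land
in their eigenspaces. -/
lemma isPrimitiveSemisimple (hF : (2 : F) ≠ 0) (h0 : a ≠ 0) (hi : a * a = a) (h : IsCoord a l) :
    IsPrimitiveSemisimpleIdempotent F a := by
  refine ⟨h0, hi, ?_, ?_⟩
  · rw [eq_top_iff]
    intro x _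
    have e : x = (x - (2 : F) • (a * x) + l x • a) + halfPart a l x + l x • a := by
      rw [halfPart_apply]; module
    rw [e]
    refine Submodule.add_mem _ (Submodule.add_mem _ ?_ ?_) ?_
    · exact Submodule.mem_iSup_of_mem 0 (h.zeroPart_mem hi x)
    · exact Submodule.mem_iSup_of_mem (1 / 2) (h.halfPart_mem hF hi x)
    · exact Submodule.mem_iSup_of_mem 1 (Submodule.smul_mem _ _ (mem_eig.2 (by simp [hi])))
  · ext x
    rw [mem_eig, Submodule.mem_span_singleton, one_smul]
    constructor
    · intro hx
      refine ⟨l x, ?_⟩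
      have := h x
      rw [hx, hx] at this
      linear_combination (norm := module) -this
    · rintro ⟨c, rfl⟩
      rw [mul_smul_comm, hi]

lemma eigenvaluesIn (hF : (2 : F) ≠ 0) (hi : a * a = a) (h : IsCoord a l) :
    EigenvaluesIn F (1 / 2) a := by
  intro μ hμ
  obtain ⟨x, hx, hx0⟩ := hμ.exists_hasEigenvector
  have hx' : a * x = μ • x := mem_eig.1 hx
  have h1 := h x
  -- Multiplying by `a` once more and subtracting eliminates `l x` and leaves the cubic `t(2t - 1)(t
  -- - 1)`.
  have h2 := congrArg (a * ·) h1
  simp only [hx', mul_smul_comm, mul_add, hi] at h1 h2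
  have h3 : (μ * ((2 * μ - 1) * (μ - 1))) • x = 0 := by
    linear_combination (norm := module) h2 - h1
  have h4 := (smul_eq_zero.1 h3).resolve_right hx0
  rcases mul_eq_zero.1 h4 with h | h
  · exact .inl h
  rcases mul_eq_zero.1 h with h | h
  · right; left; field_simp; linear_combination h
  · right; right; linear_combination h

end IsCoord

/-! ### Miyamoto involutions, and spanning by axes -/

section Miyamoto

/-- The Miyamoto involution of the axis `a`. -/
def miyamoto (a : A) (l : Module.Dual F A) : A →ₗ[F] A :=
  LinearMap.id - (2 : F) • halfPart a l

lemma miyamoto_apply (a : A) (l : Module.Dual F A) (x : A) :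
    miyamoto a l x = x - (2 : F) • halfPart a l x := rfl

variable {a : A} {l : Module.Dual F A}

lemma IsCoord.halfPart_of_half (hF : (2 : F) ≠ 0) (h0 : a ≠ 0) (h : IsCoord a l) {x : A}
    (hx : x ∈ eig F a (1 / 2)) : halfPart a l x = x := by
  rw [halfPart_apply, h.coord_of_mem_half hF h0 hx, mem_eig.1 hx]
  match_scalars <;> field_simp
  simp

lemma IsCoord.halfPart_of_even (h0 : a ≠ 0) (h : IsCoord a l) {x : A}
    (hx : x ∈ eig F a 0 ⊔ eig F a 1) : halfPart a l x = 0 := by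
  obtain ⟨y, hy, z, hz, rfl⟩ := Submodule.mem_sup.1 hx
  have hy' := mem_eig.1 hy
  have hz' := mem_eig.1 hz
  have h1 := h z
  rw [one_smul] at hz'
  rw [hz', hz'] at h1
  rw [halfPart_apply, map_add, h.coord_of_mem_zero h0 hy, mul_add, hy', hz']
  linear_combination (norm := module) (2 : F) • h1

lemma IsCoord.sub_halfPart_mem (hi : a * a = a) (h : IsCoord a l) (x : A) :
    x - halfPart a l x ∈ eig F a 0 ⊔ eig F a 1 := by
  have e : x - halfPart a l x = (x - (2 : F) • (a * x) + l x • a) + l x • a := by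
    rw [halfPart_apply]; module
  rw [e]
  exact Submodule.add_mem_sup (h.zeroPart_mem hi x)
    (Submodule.smul_mem _ _ (mem_eig.2 (by simp [hi])))

lemma IsAxis.even_mul_even (ha : IsAxis F (1 / 2) a) {x y : A}
    (hx : x ∈ eig F a 0 ⊔ eig F a 1) (hy : y ∈ eig F a 0 ⊔ eig F a 1) :
    x * y ∈ eig F a 0 ⊔ eig F a 1 := by
  obtain ⟨x0, hx0, x1, hx1, rfl⟩ := Submodule.mem_sup.1 hx
  obtain ⟨y0, hy0, y1, hy1, rfl⟩ := Submodule.mem_sup.1 hy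
  have e : (x0 + x1) * (y0 + y1) = x0 * y0 + x1 * y1 := by
    rw [mul_add, add_mul, add_mul, ha.fusion_zero_one _ hx0 _ hy1, mul_comm x1 y0,
      ha.fusion_zero_one _ hy0 _ hx1, add_zero, zero_add]
  rw [e]
  refine Submodule.add_mem_sup (ha.fusion_zero_zero _ hx0 _ hy0) ?_
  rw [ha.primitive] at hx1 hy1 ⊢
  obtain ⟨c, rfl⟩ := Submodule.mem_span_singleton.1 hx1
  obtain ⟨d, rfl⟩ := Submodule.mem_span_singleton.1 hy1
  rw [mul_smul_comm, smul_mul_assoc, ha.idem]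
  exact Submodule.smul_mem _ _ (Submodule.smul_mem _ _ (Submodule.mem_span_singleton_self a))

/-- The fusion rules make `A = (A_0 + A_1) ⊕ A_{1/2}` a `ℤ/2`-grading, and the involution is `1` on
the even part and `-1` on the odd part. -/
lemma IsAxis.miyamoto_mul (hF : (2 : F) ≠ 0) (ha : IsAxis F (1 / 2) a) (h : IsCoord a l)
    (x y : A) : miyamoto a l (x * y) = miyamoto a l x * miyamoto a l y := by
  have hxe := h.sub_halfPart_mem ha.idem x
  have hye := h.sub_halfPart_mem ha.idem y
  have hxh := h.halfPart_mem hF ha.idem x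
  have hyh := h.halfPart_mem hF ha.idem y
  simp only [miyamoto_apply]
  set xh := halfPart a l x
  set yh := halfPart a l y
  obtain ⟨xe, hx⟩ : ∃ xe, x - xh = xe := ⟨_, rfl⟩
  obtain ⟨ye, hy⟩ : ∃ ye, y - yh = ye := ⟨_, rfl⟩
  rw [hx] at hxe
  rw [hy] at hye
  rw [sub_eq_iff_eq_add] at hx hy
  have e : halfPart a l (x * y) = xe * yh + xh * ye := by
    rw [hx, hy, add_mul, mul_add, mul_add, map_add, map_add, map_add,
      h.halfPart_of_even ha.ne_zero (ha.even_mul_even hxe hye),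
      h.halfPart_of_even ha.ne_zero (ha.fusion_eta_eta _ hxh _ hyh),
      h.halfPart_of_half hF ha.ne_zero (ha.fusion_even_eta _ hxe _ hyh), mul_comm xh ye,
      h.halfPart_of_half hF ha.ne_zero (ha.fusion_even_eta _ hye _ hxh)]
    abel
  rw [e, hx, hy]
  simp only [add_mul, mul_add, sub_mul, mul_sub, smul_mul_assoc, mul_smul_comm]
  module

lemma IsCoord.miyamoto_miyamoto (hF : (2 : F) ≠ 0) (h0 : a ≠ 0) (hi : a * a = a)
    (h : IsCoord a l) (x : A) : miyamoto a l (miyamoto a l x) = x := by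
  rw [miyamoto_apply, miyamoto_apply, map_sub, map_smul,
    h.halfPart_of_half hF h0 (h.halfPart_mem hF hi x)]
  module

/-- Multiplication by an element of `A_0(a)` commutes with multiplication by `a`. -/
lemma IsAxis.mul_mul_comm_of_mem_zero (hF : (2 : F) ≠ 0) (ha : IsAxis F (1 / 2) a) {y : A}
    (hy : y ∈ eig F a 0) (z : A) : a * (y * z) = y * (a * z) := by
  obtain ⟨l, h⟩ := ha.exists_isCoord hF
  have hz0 := h.zeroPart_mem ha.idem z
  have hzh := h.halfPart_mem hF ha.idem z
  have e : z = (z - (2 : F) • (a * z) + l z • a) + halfPart a l z + l z • a := by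
    rw [halfPart_apply]; module
  obtain ⟨z0, h0⟩ : ∃ z0, z - (2 : F) • (a * z) + l z • a = z0 := ⟨_, rfl⟩
  rw [h0] at e hz0
  have hya : y * a = 0 := by rw [mul_comm, mem_eig.1 hy, zero_smul]
  have h1 := mem_eig.1 (ha.fusion_zero_zero _ hy _ hz0)
  have h2 := mem_eig.1 (ha.fusion_even_eta _ (Submodule.mem_sup_left hy) _ hzh)
  rw [e]
  simp only [mul_add, mul_smul_comm, hya, h1, h2, mem_eig.1 hz0, mem_eig.1 hzh, ha.idem]
  simp

lemma IsAxis.map_involution {η : F} (ha : IsAxis F η a) (g : A →ₗ[F] A)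
    (hg : ∀ x, g (g x) = x) (hm : ∀ x y, g (x * y) = g x * g y) : IsAxis F η (g a) := by
  have hinj : Function.Injective g := Function.LeftInverse.injective hg
  have key : ∀ μ x, x ∈ eig F (g a) μ ↔ g x ∈ eig F a μ := fun μ x => by
    rw [mem_eig, mem_eig, ← hinj.eq_iff, hm, hg, map_smul]
  have hsup : ∀ μ ν x, x ∈ eig F (g a) μ ⊔ eig F (g a) ν ↔ g x ∈ eig F a μ ⊔ eig F a ν := by
    intro μ ν x
    rw [Submodule.mem_sup, Submodule.mem_sup]
    constructor
    · rintro ⟨y, hy, z, hz, rfl⟩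
      exact ⟨g y, (key _ _).1 hy, g z, (key _ _).1 hz, (map_add g y z).symm⟩
    · rintro ⟨y, hy, z, hz, h⟩
      refine ⟨g y, (key _ _).2 (by rwa [hg]), g z, (key _ _).2 (by rwa [hg]), ?_⟩
      rw [← map_add, h, hg]
  refine ⟨⟨?_, ?_, ?_, ?_⟩, ?_, ?_, ?_, ?_, ?_⟩
  · rw [Ne, map_eq_zero_iff g hinj]; exact ha.ne_zero
  · rw [← hm, ha.idem]
  · rw [eq_top_iff]
    intro x _
    have hx : g x ∈ ⨆ μ : F, eig F a μ := by rw [ha.semisimple]; trivial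
    have hle : (⨆ μ : F, eig F a μ) ≤ (⨆ μ : F, eig F (g a) μ).comap g :=
      iSup_le fun μ y hy => Submodule.mem_iSup_of_mem μ ((key _ _).2 (by rwa [hg]))
    have := hle hx
    rwa [Submodule.mem_comap, hg] at this
  · ext x
    rw [key, ha.primitive, Submodule.mem_span_singleton, Submodule.mem_span_singleton]
    refine exists_congr fun c => ?_
    rw [← hinj.eq_iff, hg, map_smul]
  · intro μ hμ
    obtain ⟨x, hx, hx0⟩ := hμ.exists_hasEigenvector
    exact ha.eigenvalues μ (Module.End.hasEigenvalue_of_hasEigenvector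
      ⟨(key _ _).1 hx, by rwa [Ne, map_eq_zero_iff g hinj]⟩)
  · intro x hx y hy
    rw [key, hm]
    exact ha.fusion_zero_zero _ ((key _ _).1 hx) _ ((key _ _).1 hy)
  · intro x hx y hy
    rw [hsup, hm]
    exact ha.fusion_eta_eta _ ((key _ _).1 hx) _ ((key _ _).1 hy)
  · intro x hx y hy
    rw [key, hm]
    exact ha.fusion_even_eta _ ((hsup _ _ _).1 hx) _ ((key _ _).1 hy)
  · intro x hx y hy
    rw [← map_eq_zero_iff g hinj, hm]
    exact ha.fusion_zero_one _ ((key _ _).1 hx) _ ((key _ _).1 hy)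

lemma IsAxis.miyamoto {b : A} (hF : (2 : F) ≠ 0) (ha : IsAxis F (1 / 2) a) (h : IsCoord a l)
    (hb : IsAxis F (1 / 2) b) : IsAxis F (1 / 2) (miyamoto a l b) :=
  hb.map_involution _ (h.miyamoto_miyamoto hF ha.ne_zero ha.idem) (ha.miyamoto_mul hF h)

/-- An axial algebra of Jordan type `1/2` is spanned by its axes. -/
lemma IsJordanType.span_axes (hF : (2 : F) ≠ 0) (hA : IsJordanType F A (1 / 2)) :
    Submodule.span F {e : A | IsAxis F (1 / 2) e} = ⊤ := by
  obtain ⟨X, hX, htop⟩ := hA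
  have hmul : ∀ x ∈ Submodule.span F {e : A | IsAxis F (1 / 2) e},
      ∀ y ∈ Submodule.span F {e : A | IsAxis F (1 / 2) e},
      x * y ∈ Submodule.span F {e : A | IsAxis F (1 / 2) e} := by
    intro x hx y hy
    induction hx, hy using Submodule.span_induction₂ with
    | mem_mem a b ha hb =>
      obtain ⟨l, h⟩ := ha.exists_isCoord hF
      -- The involution sends `b` to `b - 4ab + 4 l(b) a`, again an axis; this is solved for `ab`.
      have e : a * b = (2⁻¹ * 2⁻¹ : F) • (b - AxialAlgebra.miyamoto a l b) + l b • a := by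
        rw [miyamoto_apply, halfPart_apply]
        match_scalars <;> field_simp <;> ring
      rw [e]
      exact Submodule.add_mem _ (Submodule.smul_mem _ _ (Submodule.sub_mem _
        (Submodule.subset_span hb) (Submodule.subset_span (ha.miyamoto hF h hb))))
        (Submodule.smul_mem _ _ (Submodule.subset_span ha))
    | zero_left => simp
    | zero_right => simp
    | add_left x y z _ _ _ hx hy => rw [add_mul]; exact Submodule.add_mem _ hx hy
    | add_right x y z _ _ _ hx hy => rw [mul_add]; exact Submodule.add_mem _ hx hy
    | smul_left r x y _ _ h => rw [smul_mul_assoc]; exact Submodule.smul_mem _ _ h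
    | smul_right r x y _ _ h => rw [mul_smul_comm]; exact Submodule.smul_mem _ _ h
  rw [eq_top_iff]
  intro x _
  have hx : x ∈ NonUnitalAlgebra.adjoin F X := by rw [htop]; trivial
  induction hx using NonUnitalAlgebra.adjoin_induction with
  | mem x hx => exact Submodule.subset_span (hX x hx)
  | add x y _ _ hx hy => exact Submodule.add_mem _ (hx trivial) (hy trivial)
  | zero => exact zero_mem _
  | mul x y _ _ hx hy => exact hmul _ (hx trivial) _ (hy trivial)
  | smul r x _ hx => exact Submodule.smul_mem _ _ (hx trivial)

/-! ### The element `a + b - 2ab` and symmetry of coordinates -/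

lemma IsCoord.mul_pairSum {a b : A} {l : Module.Dual F A} (h : IsCoord a l)
    (hi : a * a = a) : a * (a + b - (2 : F) • (a * b)) = (1 - l b) • a := by
  rw [mul_sub, mul_add, mul_smul_comm, hi]
  linear_combination (norm := module) -h b

/-- The element is the `A_0(a)`-component of `b` plus a multiple of `a`, and multiplication by
either summand commutes with `ad_a`. -/
lemma IsAxis.commute_pairSum (hF : (2 : F) ≠ 0) {a b : A} (ha : IsAxis F (1 / 2) a) (z : A) :
    a * ((a + b - (2 : F) • (a * b)) * z) = (a + b - (2 : F) • (a * b)) * (a * z) := by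
  obtain ⟨l, h⟩ := ha.exists_isCoord hF
  have e : a + b - (2 : F) • (a * b) = (b - (2 : F) • (a * b) + l b • a) + (1 - l b) • a := by
    module
  rw [e]
  simp only [add_mul _ ((1 - l b) • a), mul_add _ _ ((1 - l b) • a * z)]
  rw [ha.mul_mul_comm_of_mem_zero hF (h.zeroPart_mem ha.idem b), smul_mul_assoc, mul_smul_comm,
    smul_mul_assoc]

/-- With `s = a + b - 2ab`, computing `s(ab)` as `a(sb)` and as `b(sa)` gives `(1 - m a)ab = (1 - l
b)ab`. If `ab = 0`, both coordinates vanish. -/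
lemma IsAxis.coord_symm (hF : (2 : F) ≠ 0) {a b : A} {l m : Module.Dual F A}
    (ha : IsAxis F (1 / 2) a) (hb : IsAxis F (1 / 2) b) (hl : IsCoord a l) (hm : IsCoord b m) :
    l b = m a := by
  have e : a + b - (2 : F) • (a * b) = b + a - (2 : F) • (b * a) := by
    rw [mul_comm b a]; abel
  have h1 := IsCoord.mul_pairSum (b := b) hl ha.idem
  have h2 := IsCoord.mul_pairSum (b := a) hm hb.idem
  have h3 := ha.commute_pairSum hF (b := b) b
  have h4 := hb.commute_pairSum hF (b := a) a
  rw [e, mul_comm _ b, h2, mul_smul_comm, mul_comm b a] at h3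
  rw [← e, mul_comm _ a, h1, mul_smul_comm, e, mul_comm b a, ← h3, ← sub_eq_zero, ← sub_smul,
    smul_eq_zero] at h4
  rcases h4 with h4 | h4
  · linear_combination -h4
  · have h5 := hl b
    have h6 := hm a
    rw [mul_comm b a] at h6
    rw [h4, mul_zero, smul_zero, zero_add] at h5 h6
    rw [(smul_eq_zero.1 h5.symm).resolve_right ha.ne_zero,
      (smul_eq_zero.1 h6.symm).resolve_right hb.ne_zero]

end Miyamoto

/-! ### The Frobenius form -/

/-- If the axes span `A` then there is a symmetric bilinear form whose value at an axis `a` is the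
coordinate form of `a`. -/
lemma exists_form_isCoord (hF : (2 : F) ≠ 0)
    (hs : Submodule.span F {e : A | IsAxis F (1 / 2) e} = ⊤) :
    ∃ f : LinearMap.BilinForm F A, (∀ e, IsAxis F (1 / 2) e → IsCoord e (f e)) ∧
      ∀ x y, f x y = f y x := by
  choose l hl using fun e : {e : A // IsAxis F (1 / 2) e} => e.2.exists_isCoord hF
  have hrange : LinearMap.range
      (Finsupp.linearCombination F (Subtype.val : {e : A // IsAxis F (1 / 2) e} → A)) = ⊤ := by
    rw [Finsupp.range_linearCombination, Subtype.range_coe_subtype]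
    exact hs
  obtain ⟨s, hs'⟩ := LinearMap.exists_rightInverse_of_surjective _ hrange
  -- By symmetry of coordinates, a combination of coordinate forms, evaluated at an axis, depends
  -- only on the vector represented. So the choice of the section `s` does not matter.
  have key : ∀ v b, Finsupp.linearCombination F l v b.1 =
      l b (Finsupp.linearCombination F Subtype.val v) := fun v b => by
    induction v using Finsupp.induction_linear with
    | zero => simp
    | add v w hv hw => simp [hv, hw]
    | single a c =>
      simp [IsAxis.coord_symm hF a.2 b.2 (hl a) (hl b)]
  have hval : ∀ a : {e : A // IsAxis F (1 / 2) e},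
      (Finsupp.linearCombination F l ∘ₗ s) a.1 = l a := by
    intro a
    refine LinearMap.ext_on hs fun b hb => ?_
    have h1 := key (s a.1) ⟨b, hb⟩
    have h2 : Finsupp.linearCombination F Subtype.val (s a.1) = a.1 := LinearMap.congr_fun hs' a.1
    rw [h2] at h1
    rw [LinearMap.comp_apply]
    exact h1.trans (IsAxis.coord_symm hF hb a.2 (hl ⟨b, hb⟩) (hl a))
  refine ⟨Finsupp.linearCombination F l ∘ₗ s, fun e he => ?_, fun x y => ?_⟩
  · rw [hval ⟨e, he⟩]; exact hl ⟨e, he⟩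
  · have hx : x ∈ Submodule.span F {e : A | IsAxis F (1 / 2) e} := by rw [hs]; trivial
    have hy : y ∈ Submodule.span F {e : A | IsAxis F (1 / 2) e} := by rw [hs]; trivial
    induction hx, hy using Submodule.span_induction₂ with
    | mem_mem a b ha hb =>
      rw [hval ⟨a, ha⟩, hval ⟨b, hb⟩]
      exact IsAxis.coord_symm hF ha hb (hl ⟨a, ha⟩) (hl ⟨b, hb⟩)
    | zero_left => simp
    | zero_right => simp
    | add_left x y z _ _ _ hx hy => rw [map_add, map_add, LinearMap.add_apply, hx, hy]
    | add_right x y z _ _ _ hx hy => rw [map_add, map_add, LinearMap.add_apply, hx, hy]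
    | smul_left r x y _ _ h => rw [map_smul, map_smul, LinearMap.smul_apply, h]
    | smul_right r x y _ _ h => rw [map_smul, map_smul, LinearMap.smul_apply, h]

/-- A multiplicative involution is an isometry for a form as in `exists_form_isCoord`. -/
lemma form_map_involution (hs : Submodule.span F {e : A | IsAxis F (1 / 2) e} = ⊤)
    {f : LinearMap.BilinForm F A} (hf : ∀ e, IsAxis F (1 / 2) e → IsCoord e (f e))
    (g : A →ₗ[F] A) (hg : ∀ x, g (g x) = x) (hm : ∀ x y, g (x * y) = g x * g y) (x y : A) :
    f (g x) y = f x (g y) := by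
  have e : f ∘ₗ g = f.compl₂ g := by
    refine LinearMap.ext_on hs fun b hb => ?_
    have hb' : IsAxis F (1 / 2) (g b) := IsAxis.map_involution hb g hg hm
    have h2 : IsCoord (g b) (f b ∘ₗ g) := fun z => by
      have := congrArg g (hf b hb (g z))
      simpa [hm, hg] using this
    exact (hf _ hb').unique hb'.ne_zero h2
  exact LinearMap.congr_fun (LinearMap.congr_fun e x) y

/-- For an axis `a`, the Miyamoto involution is `1 - 4 ad_a + 4 f(a, ·)a` and is self-adjoint. The
last term is self-adjoint too, hence so is `ad_a`; axes span. -/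
lemma form_invariant (hF : (2 : F) ≠ 0) (hs : Submodule.span F {e : A | IsAxis F (1 / 2) e} = ⊤)
    {f : LinearMap.BilinForm F A} (hf : ∀ e, IsAxis F (1 / 2) e → IsCoord e (f e))
    (hsymm : ∀ x y, f x y = f y x) (x y z : A) : f (x * y) z = f x (y * z) := by
  have hy : y ∈ Submodule.span F {e : A | IsAxis F (1 / 2) e} := by rw [hs]; trivial
  induction hy using Submodule.span_induction with
  | mem a ha =>
    have ha : IsAxis F (1 / 2) a := ha
    have h := form_map_involution hs hf (miyamoto a (f a))
      ((hf a ha).miyamoto_miyamoto hF ha.ne_zero ha.idem) (ha.miyamoto_mul hF (hf a ha)) x z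
    simp only [miyamoto_apply, halfPart_apply, map_sub, map_smul, LinearMap.sub_apply,
      LinearMap.smul_apply, smul_eq_mul, hsymm x a] at h
    rw [mul_comm x a]
    refine mul_left_cancel₀ (mul_ne_zero hF hF) ?_
    linear_combination -h
  | zero => simp
  | add u v _ _ hu hv => simp [mul_add, add_mul, hu, hv]
  | smul r u _ hu =>
    rw [mul_smul_comm, smul_mul_assoc, map_smul, map_smul, LinearMap.smul_apply, hu]

/-- At an axis a Frobenius form is the coordinate form of the axis. -/
lemma IsFrobeniusForm.isCoord (hF : (2 : F) ≠ 0) {f : LinearMap.BilinForm F A}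
    (hf : IsFrobeniusForm (1 / 2) f) {a : A} (ha : IsAxis F (1 / 2) a) : IsCoord a (f a) := by
  obtain ⟨l, hl⟩ := ha.exists_isCoord hF
  suffices h : f a = l by rwa [h]
  ext x
  have h1 := congrArg (f a) (hl x)
  have hinv : ∀ y, f a (a * y) = f a y := fun y => by rw [← hf.invariant, ha.idem]
  simp only [map_add, map_smul, hinv, hf.normalized a ha, smul_eq_mul] at h1
  linear_combination h1

theorem existsUnique_isFrobeniusForm (hF : (2 : F) ≠ 0) (hA : IsJordanType F A (1 / 2)) :
    ∃! f : LinearMap.BilinForm F A, IsFrobeniusForm (1 / 2) f := by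
  have hs := hA.span_axes hF
  obtain ⟨f, hf, hsymm⟩ := exists_form_isCoord hF hs
  refine ⟨f, ⟨hsymm, form_invariant hF hs hf hsymm,
    fun e he => (hf e he).self he.ne_zero he.idem⟩, fun g hg => ?_⟩
  refine LinearMap.ext_on hs fun a ha => ?_
  have ha' : IsAxis F (1 / 2) a := ha
  exact (hg.isCoord hF ha').unique ha'.ne_zero (hf a ha')

/-! ### The quadratic identity for the `A_0(a)`-component of `b` -/

/-- The action of the element `a + b - 2ab` in terms of the projections to `A_{1/2}(a)` and
`A_{1/2}(b)`. -/
lemma IsFrobeniusForm.pairSum_mul (hF : (2 : F) ≠ 0) {f : LinearMap.BilinForm F A}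
    (hf : IsFrobeniusForm (1 / 2) f) {a b : A} (ha : IsAxis F (1 / 2) a) (z : A) :
    (2 : F) • ((a + b - (2 : F) • (a * b)) * z) =
      halfPart b (f b) z - halfPart a (f a) (halfPart b (f b) z)
        - halfPart b (f b) (halfPart a (f a) z)
        + (2 : F) • halfPart a (f a) (halfPart b (f b) (halfPart a (f a) z))
        + (1 - 2 * f a b) • halfPart a (f a) z
        + (f b z - 4 * f (a * b) z + 4 * f a b * f a z) •
          (b - (4 : F) • (a * b) + (4 * f a b) • a)
        + f b z • b + (2 * (1 - 2 * f a b) * f a z) • a := by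
  have hC := hf.isCoord hF ha
  -- With `τ` the involution of `a`, multiplication by `τ(b)` is multiplication by `b` conjugated by
  -- `τ`. The formula follows from `2(a + b - 2ab) = τ(b) + b + (2 - 4(a, b))a`.
  have h1 := ha.miyamoto_mul hF hC b (miyamoto a (f a) z)
  rw [hC.miyamoto_miyamoto hF ha.ne_zero ha.idem] at h1
  have hb2 : ∀ y, b * y = (2⁻¹ : F) • halfPart b (f b) y + f b y • b := fun y => by
    rw [halfPart_apply]; match_scalars <;> field_simp; ring
  have ha2 : ∀ y, a * y = (2⁻¹ : F) • halfPart a (f a) y + f a y • a := fun y => by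
    rw [halfPart_apply]; match_scalars <;> field_simp; ring
  have h2 : f b (miyamoto a (f a) z) = f b z - 4 * f (a * b) z + 4 * f a b * f a z := by
    rw [miyamoto_apply, halfPart_apply, mul_comm a b, hf.invariant]
    simp only [map_sub, map_smul, smul_eq_mul, hf.symm b a]
    ring
  have h3 : miyamoto a (f a) b = b - (4 : F) • (a * b) + (4 * f a b) • a := by
    rw [miyamoto_apply, halfPart_apply]; module
  rw [hb2 (miyamoto a (f a) z), h2, map_add, map_smul, map_smul, h3] at h1
  set k := f b z - 4 * f (a * b) z + 4 * f a b * f a z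
  obtain ⟨c, hc⟩ : ∃ c, b - (4 : F) • (a * b) + (4 * f a b) • a = c := ⟨_, rfl⟩
  rw [hc] at h1 ⊢
  have h4 : (4 : F) • ((a + b - (2 : F) • (a * b)) * z) =
      (2 : F) • (c * z) + (2 : F) • (b * z) + (2 - 4 * f a b) • (2 : F) • (a * z) := by
    rw [← hc]
    simp only [add_mul, sub_mul, smul_mul_assoc]
    module
  rw [← h1, hb2 z, ha2 z] at h4
  simp only [miyamoto_apply, map_sub, map_smul] at h4
  refine smul_right_injective A hF ?_
  simp only
  rw [smul_smul, show (2 * 2 : F) = 4 by norm_num, h4]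
  match_scalars <;> field_simp <;> ring

/-- The element `b - 2ab + (a,b)a`, which is the `A_0(a)`-component of `b`, satisfies an identity
of the type of an axis, up to a scalar. -/
lemma IsFrobeniusForm.zeroPart_mul_zeroPart_mul (hF : (2 : F) ≠ 0) {f : LinearMap.BilinForm F A}
    (hf : IsFrobeniusForm (1 / 2) f) {a b : A} (ha : IsAxis F (1 / 2) a)
    (hb : IsAxis F (1 / 2) b) {x : A} (hx : x = b - (2 : F) • (a * b) + f a b • a) (z : A) :
    (2 : F) • (x * (x * z)) = (1 - f a b) • (x * z) + f x z • x := by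
  have hCa := hf.isCoord hF ha
  have hCb := hf.isCoord hF hb
  obtain ⟨φ, hφ⟩ : ∃ φ, f a b = φ := ⟨_, rfl⟩
  have hφ' : f b a = φ := by rw [hf.symm, hφ]
  have hx0 : x ∈ eig F a 0 := by rw [hx]; exact hCa.zeroPart_mem ha.idem b
  have hax : a * x = 0 := by rw [mem_eig.1 hx0, zero_smul]
  have haa : f a a = 1 := hf.normalized a ha
  have hbb : f b b = 1 := hf.normalized b hb
  have haab : f a (a * b) = φ := by rw [← hf.invariant, ha.idem, hφ]
  have hbab : f b (a * b) = φ := by rw [mul_comm, ← hf.invariant, hb.idem, hφ']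
  obtain ⟨s, hs⟩ : ∃ s, a + b - (2 : F) • (a * b) = s := ⟨_, rfl⟩
  have hs' : b + a - (2 : F) • (b * a) = s := by rw [← hs, mul_comm b a, add_comm]
  have hxs : x = s - (1 - φ) • a := by rw [hx, ← hs, hφ]; module
  have hbs : b * s = (1 - φ) • b := by
    rw [← hs', IsCoord.mul_pairSum hCb hb.idem, hφ']
  -- The expansion is not symmetric in `a` and `b`, but `s` is. Comparing both versions gives
  -- relations between words in the projections `p` and `r`.
  have L1 := hf.pairSum_mul hF ha (b := b)
  have L2 := hf.pairSum_mul hF hb (b := a)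
  have rr : ∀ y, halfPart b (f b) (halfPart b (f b) y) = halfPart b (f b) y := fun y =>
    hCb.halfPart_of_half hF hb.ne_zero (hCb.halfPart_mem hF hb.idem y)
  have pa : halfPart a (f a) a = 0 := by
    rw [halfPart_apply, ha.idem, haa]; module
  have pb : halfPart a (f a) b = (2 : F) • (a * b) - (2 * φ) • a := by
    rw [halfPart_apply, hφ]
  have pab : halfPart a (f a) (a * b) = a * b - φ • a := by
    rw [halfPart_apply, haab, hCa b, hφ]; module
  have rb : halfPart b (f b) b = 0 := by
    rw [halfPart_apply, hb.idem, hbb]; module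
  have ra : halfPart b (f b) a = (2 : F) • (a * b) - (2 * φ) • b := by
    rw [halfPart_apply, hφ', mul_comm b a]
  have rab : halfPart b (f b) (a * b) = a * b - φ • b := by
    rw [halfPart_apply, hbab, mul_comm a b, hCb a, hφ']; module
  simp only [hs, hφ] at L1
  simp only [hs', hφ'] at L2
  simp only [mul_comm b a] at L2
  rw [hφ]
  have hfs : ∀ y, f b (s * y) = (1 - φ) * f b y := fun y => by
    rw [← hf.invariant, hbs, map_smul, LinearMap.smul_apply, smul_eq_mul]
  set p := halfPart a (f a)
  set r := halfPart b (f b)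
  have case_half : ∀ z ∈ eig F a (1 / 2),
      (2 : F) • (x * (x * z)) = (1 - φ) • (x * z) + f x z • x := by
    intro z hz
    have haz : a * z = (2⁻¹ : F) • z := by rw [mem_eig.1 hz, one_div]
    have pz : p z = z := hCa.halfPart_of_half hF ha.ne_zero hz
    have fz : f a z = 0 := hCa.coord_of_mem_half hF ha.ne_zero hz
    have fabz : ∀ y, f (a * b) y = f b (a * y) := fun y => by rw [mul_comm, hf.invariant]
    have fxz : f x z = 0 := by
      have h1 : f x (a * z) = 0 := by rw [← hf.invariant, mul_comm, hax]; simp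
      rw [haz, map_smul, smul_eq_mul] at h1
      exact (mul_eq_zero.1 h1).resolve_left (inv_ne_zero hF)
    obtain ⟨t, ht⟩ : ∃ t, (2 : F) • (s * z) - (1 - φ) • z = t := ⟨_, rfl⟩
    have hxz : (2 : F) • (x * z) = t := by
      rw [hxs, sub_mul, smul_mul_assoc, haz, ← ht]
      match_scalars <;> field_simp
    have htm : t ∈ eig F a (1 / 2) := by
      rw [← hxz]
      exact Submodule.smul_mem _ _ (ha.fusion_even_eta _ (Submodule.mem_sup_left hx0) _ hz)
    have hat : a * t = (2⁻¹ : F) • t := by rw [mem_eig.1 htm, one_div]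
    have pt : p t = t := hCa.halfPart_of_half hF ha.ne_zero htm
    have ft : f a t = 0 := hCa.coord_of_mem_half hF ha.ne_zero htm
    have fbt : f b t = (1 - φ) * f b z := by
      rw [← ht, map_sub, map_smul, map_smul, hfs]
      simp only [smul_eq_mul]; ring
    have h1 := L1 z
    have h2 := L2 z
    have h3 := L1 t
    simp only [fabz, haz, hat, pz, fz, pt, ft, fbt, map_smul, smul_eq_mul] at h1 h2 h3
    set β := f b z
    -- Adding the two expansions of `sz` puts `2t` in the image of `r`, up to `β` times a
    -- combination of `a`, `b`, `ab`. As `r` is a projection, `r t = t` up to such terms.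
    have e1 : (2 : F) • t = r ((2 : F) • p (r z) - (2 * φ) • z) +
        β • ((4 : F) • (a * b) - (4 * φ) • a + (4 * φ - 2) •
          (a - (4 : F) • (a * b) + (4 * φ - 1) • b)) := by
      rw [map_sub, map_smul, map_smul, ← ht]
      linear_combination (norm := skip) h1 + h2
      match_scalars <;> field_simp <;> ring
    have e2 := congrArg r e1
    rw [map_add, rr] at e2
    have e3 : (2 : F) • r t = (2 : F) • t + β • (r ((4 : F) • (a * b) - (4 * φ) • a +
        (4 * φ - 2) • (a - (4 : F) • (a * b) + (4 * φ - 1) • b)) -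
        ((4 : F) • (a * b) - (4 * φ) • a +
        (4 * φ - 2) • (a - (4 : F) • (a * b) + (4 * φ - 1) • b))) := by
      rw [map_smul, map_smul] at e2
      linear_combination (norm := module) e2 - e1
    have e4 := congrArg p e3
    simp only [map_add, map_sub, map_smul, pa, pb, pab, rb, ra, rab, pt,
      map_zero] at e4
    -- Since `p t = t`, modulo the correction terms `p (r t)` is `t`, and the expansion of `st`
    -- collapses; the corrections cancel.
    have e5 : (2 : F) • (s * t) = (2 * (1 - φ)) • t := by
      refine smul_right_injective A hF ?_
      simp only
      linear_combination (norm := skip) (2 : F) • h3 + e4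
      match_scalars <;> field_simp <;> ring
    have e6 : (2 : F) • (x * t) = (1 - φ) • t := by
      rw [hxs, sub_mul, smul_mul_assoc, hat, smul_sub, e5]
      match_scalars; field_simp; ring
    refine smul_right_injective A hF ?_
    simp only
    rw [fxz, zero_smul, add_zero, smul_comm _ (1 - φ), hxz, ← e6, ← hxz, mul_smul_comm]
  have case_zero : ∀ z ∈ eig F a 0,
      (2 : F) • (x * (x * z)) = (1 - φ) • (x * z) + f x z • x := by
    intro z hz
    have haz : a * z = 0 := by rw [mem_eig.1 hz, zero_smul]
    have fz : f a z = 0 := hCa.coord_of_mem_zero ha.ne_zero hz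
    have pz : p z = 0 := hCa.halfPart_of_even ha.ne_zero (Submodule.mem_sup_left hz)
    have fabz : ∀ y, f (a * b) y = f b (a * y) := fun y => by rw [mul_comm, hf.invariant]
    have fxz : f x z = f b z := by
      rw [hx]
      simp [fabz, haz, fz]
    obtain ⟨t, ht⟩ : ∃ t, (2 : F) • (s * z) = t := ⟨_, rfl⟩
    have hxz : (2 : F) • (x * z) = t := by
      rw [hxs, sub_mul, smul_mul_assoc, haz, smul_zero, sub_zero, ht]
    have htm : t ∈ eig F a 0 := by
      rw [← hxz]
      exact Submodule.smul_mem _ _ (ha.fusion_zero_zero _ hx0 _ hz)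
    have hat : a * t = 0 := by rw [mem_eig.1 htm, zero_smul]
    have pt : p t = 0 := hCa.halfPart_of_even ha.ne_zero (Submodule.mem_sup_left htm)
    have ft : f a t = 0 := hCa.coord_of_mem_zero ha.ne_zero htm
    have fbt : f b t = 2 * (1 - φ) * f b z := by
      rw [← ht, map_smul, hfs, smul_eq_mul]; ring
    have h1 := L1 z
    have h2 := L2 z
    have h3 := L1 t
    simp only [fabz, haz, hat, pz, fz, pt, ft, fbt, ht, map_zero] at h1 h2 h3
    set β := f b z
    -- Here the difference of the two expansions reduces `rpr` to `φ r` on `z`, up to multiples of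
    -- `β`.
    have e1 : (2 : F) • r (p (r z)) = (2 * φ) • r z + β • ((2 : F) • b - (4 : F) • (a * b)
        + (4 * φ) • a - (4 * φ) • (a - (4 : F) • (a * b) + (4 * φ) • b)
        - (2 * (1 - 2 * φ)) • b) := by
      linear_combination (norm := module) h1 - h2
    have e2 := congrArg r h1
    simp only [map_add, map_sub, map_smul, rr, rb, ra, rab, map_zero] at e2
    have e3 := congrArg p e2
    have e4 := congrArg p e1
    simp only [map_add, map_sub, map_smul, pb, pa, pab, map_zero] at e3 e4
    -- Modulo `β`-terms, `t = (1 - p) r z` and `2st = (1 - p) r t`, while `r t = (1 - φ) r z` by the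
    -- reduction of `rpr`.
    have e5 : (2 : F) • (s * t) = (1 - φ) • t + (2 * β) • x := by
      refine smul_right_injective A hF ?_
      simp only
      rw [hx, hφ]
      linear_combination (norm := module) (2 : F) • h3 + (2 : F) • e2 - (2 : F) • e3 - e1 + e4
        - (2 * (1 - φ)) • h1
    have e6 : x * t = s * t := by
      rw [hxs, sub_mul, smul_mul_assoc, hat, smul_zero, sub_zero]
    refine smul_right_injective A hF ?_
    simp only
    rw [fxz, ← mul_smul_comm, hxz, e6, e5, smul_add, smul_comm (2 : F) (1 - φ), hxz, smul_smul]
  have e : z = (z - (2 : F) • (a * z) + f a z • a) + p z + f a z • a := by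
    rw [halfPart_apply]; module
  have h1 := case_zero _ (hCa.zeroPart_mem ha.idem z)
  have h2 := case_half _ (hCa.halfPart_mem hF ha.idem z)
  have hxa : x * a = 0 := by rw [mul_comm, hax]
  have fxa : f x a = 0 := by rw [hf.symm]; exact hCa.coord_of_mem_zero ha.ne_zero hx0
  obtain ⟨z0, hz0⟩ : ∃ z0, z - (2 : F) • (a * z) + f a z • a = z0 := ⟨_, rfl⟩
  rw [hz0] at e h1
  obtain ⟨z1, hz1⟩ : ∃ z1, p z = z1 := ⟨_, rfl⟩
  obtain ⟨k, hk⟩ : ∃ k, f a z = k := ⟨_, rfl⟩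
  rw [hz1] at e h2
  rw [hk] at e
  rw [e]
  simp only [mul_add, mul_smul_comm, hxa, map_add, map_smul, fxa, smul_zero, add_zero]
  linear_combination (norm := module) h1 + h2

theorem isPrimitiveSemisimpleIdempotent_xElem (hF : (2 : F) ≠ 0) {f : LinearMap.BilinForm F A}
    (hf : IsFrobeniusForm (1 / 2) f) {a b : A} (ha : IsAxis F (1 / 2) a)
    (hb : IsAxis F (1 / 2) b) (hab : f a b ≠ 1) :
    IsPrimitiveSemisimpleIdempotent F (xElem f a b) ∧ EigenvaluesIn F (1 / 2) (xElem f a b) := by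
  have hCa := hf.isCoord hF ha
  have hCb := hf.isCoord hF hb
  have h1φ : 1 - f a b ≠ 0 := sub_ne_zero.2 (Ne.symm hab)
  obtain ⟨y, hy⟩ : ∃ y, y = b - (2 : F) • (a * b) + f a b • a := ⟨_, rfl⟩
  have hxy : xElem f a b = (1 - f a b)⁻¹ • y := by
    rw [xElem, hy, ← neg_sub 1 (f a b), inv_neg]; module
  obtain ⟨s, hs⟩ : ∃ s, a + b - (2 : F) • (a * b) = s := ⟨_, rfl⟩
  have hs' : b + a - (2 : F) • (b * a) = s := by rw [← hs, mul_comm b a, add_comm]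
  have hys : y = s - (1 - f a b) • a := by rw [hy, ← hs]; module
  have has : a * s = (1 - f a b) • a := by
    rw [← hs, IsCoord.mul_pairSum hCa ha.idem]
  have hbs : b * s = (1 - f a b) • b := by
    rw [← hs', IsCoord.mul_pairSum hCb hb.idem, hf.symm b a]
  have hsab : s * (a * b) = (1 - f a b) • (a * b) := by
    -- `s(ab) = a(sb)`, and `b` is an eigenvector of `s`.
    rw [← hs, ← ha.commute_pairSum hF b, hs, mul_comm s b, hbs, mul_smul_comm]
  have hss : s * s = (1 - f a b) • s := by
    have : s * s = s * (a + b - (2 : F) • (a * b)) := by rw [hs]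
    rw [this, mul_sub, mul_add, mul_smul_comm, hsab, mul_comm s a, mul_comm s b, has, hbs, ← hs]
    module
  have hyy : y * y = (1 - f a b) • y := by
    rw [hys]
    simp only [mul_sub, sub_mul, mul_smul_comm, smul_mul_assoc, ha.idem, hss, mul_comm s a, has]
    module
  -- If `y = 0` then `s` is a multiple of `a`, so `bs = (1 - φ)b` forces `ab = b`. Primitivity of
  -- `a` gives `b = ca`, and idempotence gives `c = 1`, so `φ = 1`.
  have hy0 : y ≠ 0 := by
    intro h0
    rw [h0] at hys
    have h1 : s = (1 - f a b) • a := (sub_eq_zero.1 hys.symm)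
    rw [h1, mul_smul_comm, mul_comm b a] at hbs
    have h2 : a * b = b := smul_right_injective A h1φ hbs
    have h3 : b ∈ eig F a 1 := mem_eig.2 (by rw [h2, one_smul])
    rw [ha.primitive] at h3
    obtain ⟨c, hc⟩ := Submodule.mem_span_singleton.1 h3
    have h4 : f a b = c := by rw [← hc, map_smul, hf.normalized a ha, smul_eq_mul, mul_one]
    have h5 := hf.normalized b hb
    have h6 := hb.idem
    rw [← hc, smul_mul_assoc, mul_smul_comm, ha.idem, smul_smul] at h6
    have h7 : c * c = c := smul_left_injective F ha.ne_zero h6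
    have h8 : c ≠ 0 := by
      rintro rfl
      exact hb.ne_zero (by rw [← hc, zero_smul])
    exact hab (h4.trans (mul_left_cancel₀ h8 (h7.trans (mul_one c).symm)))
  have hC : IsCoord (xElem f a b) (f (xElem f a b)) := fun z => by
    have h := hf.zeroPart_mul_zeroPart_mul hF ha hb hy z
    rw [hxy]
    simp only [smul_mul_assoc, mul_smul_comm, map_smul, LinearMap.smul_apply, smul_eq_mul]
    rw [smul_comm (2 : F), smul_comm (2 : F), h]
    match_scalars <;> field_simp
  have hi : xElem f a b * xElem f a b = xElem f a b := by
    rw [hxy, smul_mul_assoc, mul_smul_comm, hyy, smul_smul _ (1 - f a b), inv_mul_cancel₀ h1φ,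
      one_smul]
  have h0 : xElem f a b ≠ 0 := by
    rw [hxy]; exact smul_ne_zero (inv_ne_zero h1φ) hy0
  exact ⟨hC.isPrimitiveSemisimple hF h0 hi, hC.eigenvaluesIn hF hi⟩

end

end AxialAlgebra


theorem mainTheorem3 {F A : Type*} [Field F] (hF : (2 : F) ≠ 0)
    [NonUnitalNonAssocCommRing A] [Module F A] [SMulCommClass F A A] [IsScalarTower F A A]
    (hA : AxialAlgebra.IsJordanType F A (1 / 2)) :
    (∃! f : LinearMap.BilinForm F A, AxialAlgebra.IsFrobeniusForm (1 / 2) f) ∧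
    ∀ f : LinearMap.BilinForm F A, AxialAlgebra.IsFrobeniusForm (1 / 2) f →
      ∀ a b : A, AxialAlgebra.IsAxis F (1 / 2) a → AxialAlgebra.IsAxis F (1 / 2) b →
        a ≠ b → f a b ≠ 1 →
        AxialAlgebra.IsPrimitiveSemisimpleIdempotent F (AxialAlgebra.xElem f a b) ∧
        AxialAlgebra.EigenvaluesIn F (1 / 2) (AxialAlgebra.xElem f a b) :=
  ⟨AxialAlgebra.existsUnique_isFrobeniusForm hF hA, fun _ hf _ _ ha hb _ hab =>
    AxialAlgebra.isPrimitiveSemisimpleIdempotent_xElem hF hf ha hb hab⟩
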